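/- Let $r\ge 0$, $\lambda>0$, $\delta_1,\delta_2>0$ with $\delta_1+\delta_2=1$, and $c_1,c_2\in\mathbb R$ with $c_1/\delta_1>c_2/\delta_2$. Let $(N(t))_{t\ge0}$ be a Poisson process with intensity $\lambda$ and arrival times $\theta_1<\theta_2<\cdots$ (so that $\theta_1,\theta_2-\theta_1,\theta_3-\theta_2,\ldots$ are i.i.d. exponential with parameter $\lambda$), and let $\sigma_1,\sigma_2,\ldots$ be i.i.d. nonnegative random variables, independent of the arrival times. For $u_1,u_2\in\mathbb R$, $t\ge 0$ and $i=1,2$ put $$U_i(t)=e^{rt}u_i+c_i\int_0^t e^{r(t-v)}\,dv-\delta_i\sum_{k=1}^{N(t)}e^{r(t-\theta_k)}\sigma_k,$$ let $T_{\min}(u_1,u_2)=\inf\{t\ge 0:\min\{U_1(t),U_2(t)\}<0\}$ (with $\inf\emptyset=\infty$), and for $T>0$ let $$\Psi_{\min}(x_1,x_2,T)=P\{T_{\min}(\delta_1x_1,\delta_2x_2)\le T\}.$$ Let $\overline{F_T}(x)=P\{e^{-rV}\sigma_1>x\}$, where $V$ is uniformly distributed on $(0,T]$ and independent of $\sigma_1$.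 Suppose that $P\{\sigma_1>x\}=L(x)/x^{\alpha}$ for all $x>0$, where $\alpha>0$ and $L:(0,\infty)\to\mathbb R$ is continuous and slowly varying at infinity (that is, $L$ is eventually positive and $L(tx)/L(x)\to1$ as $x\to\infty$ for every $t>0$), with $\lim_{x\to\infty}L(x)=\infty$. Then, for every $T>0$, $$\lim_{x_2\ge x_1\to\infty}\frac{\Psi_{\min}(x_1,x_2,T)}{\lambda T\,\overline{F_T}(x_1)}=1,$$ that is, for every $\varepsilon>0$ there is an $M$ such that the ratio differs from $1$ by less than $\varepsilon$ whenever $x_2\ge x_1\ge M$. -/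

import Mathlib

open MeasureTheory ProbabilityTheory Filter Topology

noncomputable section

namespace JointRuin

variable {Ω : Type*}

/-- The arrival time of the claim with index `k` (indices start at `0`), the sum of the first
`k + 1` waiting times. -/
def arrivalTime (τ : ℕ → Ω → ℝ) (k : ℕ) (ω : Ω) : ℝ :=
  ∑ i ∈ Finset.range (k + 1), τ i ω

/-- The number `N(t)` of claims that have arrived up to time `t`. -/
def claimCount (τ : ℕ → Ω → ℝ) (t : ℝ) (ω : Ω) : ℕ :=
  {k : ℕ | arrivalTime τ k ω ≤ t}.ncard

/-- The claims arrive according to a Poisson process of intensity `lam` (i.i.d. exponential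
waiting times `τ k`); the claim sizes `σ k` are nonnegative, i.i.d., and independent of the
arrival process. -/
structure IsClaimModel [MeasurableSpace Ω] (P : Measure Ω) (lam : ℝ) (τ σ : ℕ → Ω → ℝ) :
    Prop where
  measurable_wait : ∀ k, Measurable (τ k)
  measurable_size : ∀ k, Measurable (σ k)
  law_wait : ∀ k, P.map (τ k) = expMeasure lam
  indep_wait : iIndepFun τ P
  nonneg_size : ∀ k, ∀ᵐ ω ∂P, 0 ≤ σ k ω
  identDistrib_size : ∀ k, IdentDistrib (σ k) (σ 0) P P
  indep_size : iIndepFun σ P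
  indep_wait_size : IndepFun (fun ω k => τ k ω) (fun ω k => σ k ω) P

/-- The reserve `U(t) = e^{rt} u + c ∫₀ᵗ e^{r(t-v)} dv - δ ∫₀ᵗ e^{r(t-v)} dS_v` where
`S_t = ∑_{k < N(t)} σ k`; the integral against the step function `S` is the sum over its jumps. -/
def reserve (r c δ u : ℝ) (τ σ : ℕ → Ω → ℝ) (t : ℝ) (ω : Ω) : ℝ :=
  Real.exp (r * t) * u + c * (∫ v in (0 : ℝ)..t, Real.exp (r * (t - v)))
    - δ * ∑ k ∈ Finset.range (claimCount τ t ω),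
        Real.exp (r * (t - arrivalTime τ k ω)) * σ k ω

/-- The joint ruin time `inf {t ≥ 0 | min (U₁(t)) (U₂(t)) < 0}`, with `inf ∅ = ∞`. -/
def minRuinTime (r c₁ c₂ δ₁ δ₂ u₁ u₂ : ℝ) (τ σ : ℕ → Ω → ℝ) (ω : Ω) : EReal :=
  sInf ((fun t : ℝ => (t : EReal)) ''
    {t : ℝ | 0 ≤ t ∧ min (reserve r c₁ δ₁ u₁ τ σ t ω) (reserve r c₂ δ₂ u₂ τ σ t ω) < 0})

/-- The finite time ruin probability `P(T_min(δ₁ x₁, δ₂ x₂) ≤ T)`, as a function of the scaled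
initial reserves `xᵢ = uᵢ / δᵢ`. -/
def minRuinProb [MeasurableSpace Ω] (P : Measure Ω) (r c₁ c₂ δ₁ δ₂ : ℝ) (τ σ : ℕ → Ω → ℝ)
    (x₁ x₂ T : ℝ) : ℝ :=
  P.real {ω | minRuinTime r c₁ c₂ δ₁ δ₂ (δ₁ * x₁) (δ₂ * x₂) τ σ ω ≤ (T : EReal)}

/-- The law of `e^{-rV} σ` where `V` is uniform on `(0, T]`, `σ` has law `ν`, and `V` and `σ` are
independent. -/
def discountedLaw (r T : ℝ) (ν : Measure ℝ) : Measure ℝ :=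
  ((cond (volume : Measure ℝ) (Set.Ioc 0 T)).prod ν).map
    (fun p : ℝ × ℝ => Real.exp (-(r * p.1)) * p.2)

/-- The tail at `x` of the distribution function of `discountedLaw r T ν`. -/
def discountedTail (r T : ℝ) (ν : Measure ℝ) (x : ℝ) : ℝ :=
  (discountedLaw r T ν).real (Set.Ioi x)

/-- `L` is slowly varying at infinity. -/
def SlowlyVarying (L : ℝ → ℝ) : Prop :=
  (∀ᶠ x in atTop, 0 < L x) ∧ ∀ t : ℝ, 0 < t → Tendsto (fun x => L (t * x) / L x) atTop (𝓝 1)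

/-- The filter of pairs `(x₁, x₂)` with `x₂ ≥ x₁ → ∞`. -/
def orderedAtTop : Filter (ℝ × ℝ) :=
  comap Prod.fst atTop ⊓ 𝓟 {p : ℝ × ℝ | p.1 ≤ p.2}

end JointRuin

end

/-! Discounting to time 0 and dividing by `δᵢ` exposes both lines to the same process
`discountedClaims`: line `i` is ruined at time `t` iff that process exceeds `xᵢ + (cᵢ/δᵢ) * annuity
r t`. The premium term is bounded on bounded time intervals, so for `x₁ ≤ x₂` the ruin event lies,
almost surely, between the events that the discounted claims up to `T` exceed `x₁` plus a constant
and `x₁` minus a constant (`minRuinTime_le_of_lt`, `lt_of_minRuinTime_le`).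

It remains to see that the discounted claims exceed `x` with probability asymptotic to `λT` times
the discounted tail, by the principle of a single big jump. The Erlang densities of the arrival
times sum to `λ`, so the expected number of discounted claims above `x` is exactly this quantity
(`tsum_largeClaim`). Bonferroni's inequality gives the lower bound. For the upper bound, a sum of
`n` terms above `x` has one term above `(1 - η) x` or two terms above `η x / n`.

Events with two large claims cost the square of the size tail. The factor growing with `n` is
polynomial times geometric, by dominated variation, and the factorial decay of the arrival
probabilities makes it summable. The squared tail is negligible against the averaged one; regular
variation then permits `η → 0` and absorbs the bounded shifts (`tendsto_div_of_tail_bounds`,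
`tendsto_shift_div`). -/

noncomputable section

/-! ### Erlang laws of the arrival times and the renewal measure. -/

namespace JointRuin

variable {Ω : Type*}

open scoped ENNReal

/-- The density of the Erlang distribution with shape `k + 1` and rate `lam`. -/
def erlangPDFReal (lam : ℝ) (k : ℕ) (v : ℝ) : ℝ :=
  if 0 ≤ v then lam * (lam * v) ^ k / k.factorial * Real.exp (-(lam * v)) else 0

theorem measurable_erlangPDFReal (lam : ℝ) (k : ℕ) : Measurable (erlangPDFReal lam k) := by
  unfold erlangPDFReal
  exact Measurable.ite measurableSet_Ici (by fun_prop) measurable_const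

theorem erlangPDFReal_nonneg {lam : ℝ} (hlam : 0 < lam) (k : ℕ) (v : ℝ) :
    0 ≤ erlangPDFReal lam k v := by
  unfold erlangPDFReal
  split_ifs with h
  · positivity
  · exact le_rfl

theorem exponentialPDF_eq_erlang (lam : ℝ) :
    exponentialPDF lam = fun v => ENNReal.ofReal (erlangPDFReal lam 0 v) := by
  funext v
  simp [exponentialPDF_eq, erlangPDFReal]

/-- The two exponentials multiply to a factor free of `y`, so the convolution reduces to integrating
a monomial. -/
theorem erlangPDFReal_mul_zero {lam : ℝ} (k : ℕ) (x y : ℝ) :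
    erlangPDFReal lam k y * erlangPDFReal lam 0 (-y + x) =
      (Set.Icc 0 x).indicator
        (fun y => lam ^ (k + 2) / k.factorial * Real.exp (-(lam * x)) * y ^ k) y := by
  by_cases h : y ∈ Set.Icc 0 x
  · have h1 : 0 ≤ -y + x := by linarith [h.2]
    rw [Set.indicator_of_mem h, erlangPDFReal, erlangPDFReal, if_pos h.1, if_pos h1]
    have : Real.exp (-(lam * x)) = Real.exp (-(lam * y)) * Real.exp (-(lam * (-y + x))) := by
      rw [← Real.exp_add]; ring_nf
    rw [this, mul_pow]
    simp only [pow_zero, Nat.factorial_zero, Nat.cast_one]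
    ring
  · rw [Set.indicator_of_notMem h, erlangPDFReal, erlangPDFReal]
    rw [Set.mem_Icc, not_and_or] at h
    rcases h with h | h
    · rw [if_neg h, zero_mul]
    · rw [if_neg (c := 0 ≤ -y + x) (by linarith [not_le.1 h]), mul_zero]

theorem lconvolution_erlang {lam : ℝ} (hlam : 0 < lam) (k : ℕ) (x : ℝ) :
    ∫⁻ y, ENNReal.ofReal (erlangPDFReal lam k y) * ENNReal.ofReal (erlangPDFReal lam 0 (-y + x)) =
      ENNReal.ofReal (erlangPDFReal lam (k + 1) x) := by
  simp_rw [← ENNReal.ofReal_mul (erlangPDFReal_nonneg hlam k _)]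
  by_cases hx : 0 ≤ x
  · simp_rw [erlangPDFReal_mul_zero k x]
    rw [← ofReal_integral_eq_lintegral_ofReal, integral_indicator measurableSet_Icc,
      integral_Icc_eq_integral_Ioc, ← intervalIntegral.integral_of_le hx,
      intervalIntegral.integral_const_mul, integral_pow, erlangPDFReal, if_pos hx]
    · congr 1
      rw [Nat.factorial_succ]
      push_cast
      field_simp
      rw [zero_pow (Nat.succ_ne_zero k), sub_zero, mul_pow]
      ring
    · refine IntegrableOn.integrable_indicator ?_ measurableSet_Icc
      exact (by fun_prop : Continuous _).continuousOn.integrableOn_Icc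
    · refine ae_of_all _ fun y => Set.indicator_nonneg (fun z hz => ?_) y
      have := hz.1
      positivity
  · have : ∀ y, erlangPDFReal lam k y * erlangPDFReal lam 0 (-y + x) = 0 := by
      intro y
      rw [erlangPDFReal, erlangPDFReal]
      by_cases hy : 0 ≤ y
      · rw [if_neg (c := 0 ≤ -y + x) (by linarith), mul_zero]
      · rw [if_neg hy, zero_mul]
    simp_rw [this]
    simp [erlangPDFReal, hx]

theorem arrivalTime_succ (τ : ℕ → Ω → ℝ) (k : ℕ) :
    arrivalTime τ (k + 1) = arrivalTime τ k + τ (k + 1) := by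
  funext ω
  simp [arrivalTime, Finset.sum_range_succ _ (k + 1)]

section Arrival

variable [MeasurableSpace Ω] {P : Measure Ω} [IsProbabilityMeasure P] {lam : ℝ}
  {τ σ : ℕ → Ω → ℝ}

theorem measurable_arrivalTime (hτ : ∀ k, Measurable (τ k)) (k : ℕ) :
    Measurable (arrivalTime τ k) :=
  Finset.measurable_fun_sum _ fun i _ => hτ i

/-- The arrival time with index `k` has an Erlang distribution. -/
theorem map_arrivalTime (hτ : ∀ k, Measurable (τ k)) (hlaw : ∀ k, P.map (τ k) = expMeasure lam)
    (hind : iIndepFun τ P) (hlam : 0 < lam) (k : ℕ) :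
    P.map (arrivalTime τ k) =
      volume.withDensity fun v => ENNReal.ofReal (erlangPDFReal lam k v) := by
  have hexp : expMeasure lam =
      volume.withDensity fun v => ENNReal.ofReal (erlangPDFReal lam 0 v) := by
    rw [← exponentialPDF_eq_erlang]; rfl
  induction k with
  | zero =>
    have : arrivalTime τ 0 = τ 0 := by funext ω; simp [arrivalTime]
    rw [this, hlaw 0, hexp]
  | succ k ih =>
    have hi : IndepFun (arrivalTime τ k) (τ (k + 1)) P := by
      have := hind.indepFun_sum_range_succ hτ (k + 1)
      convert this using 1
      funext ω
      simp [arrivalTime]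
    rw [arrivalTime_succ, hi.map_add_eq_map_conv_map (measurable_arrivalTime hτ k) (hτ _), ih,
      hlaw, hexp, conv_withDensity_eq_lconvolution
        (measurable_erlangPDFReal lam k).ennreal_ofReal
        (measurable_erlangPDFReal lam 0).ennreal_ofReal]
    congr 1
    funext x
    exact lconvolution_erlang hlam k x

theorem hasSum_erlangPDFReal (lam : ℝ) {v : ℝ} (hv : 0 ≤ v) :
    HasSum (fun k => erlangPDFReal lam k v) lam := by
  have h := ((NormedSpace.expSeries_div_hasSum_exp (lam * v)).mul_left lam).mul_right
    (Real.exp (-(lam * v)))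
  rw [← Real.exp_eq_exp_ℝ, mul_assoc, ← Real.exp_add, add_neg_cancel, Real.exp_zero,
    mul_one] at h
  have he : (fun k => erlangPDFReal lam k v) =
      fun k : ℕ => lam * ((lam * v) ^ k / k.factorial) * Real.exp (-(lam * v)) := by
    funext k
    rw [erlangPDFReal, if_pos hv, mul_div_assoc]
  rw [he]
  exact h

/-- The renewal measure of the Poisson process is `lam` times the Lebesgue measure. -/
theorem tsum_lintegral_map_arrivalTime (hτ : ∀ k, Measurable (τ k))
    (hlaw : ∀ k, P.map (τ k) = expMeasure lam) (hind : iIndepFun τ P) (hlam : 0 < lam)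
    {h : ℝ → ℝ≥0∞} (hh : Measurable h) :
    ∑' k, ∫⁻ v, h v ∂(P.map (arrivalTime τ k)) =
      ENNReal.ofReal lam * ∫⁻ v in Set.Ici 0, h v := by
  have hm : ∀ k, Measurable fun v => ENNReal.ofReal (erlangPDFReal lam k v) := fun k =>
    (measurable_erlangPDFReal lam k).ennreal_ofReal
  simp_rw [map_arrivalTime hτ hlaw hind hlam, lintegral_withDensity_eq_lintegral_mul _ (hm _) hh]
  rw [← lintegral_tsum fun k => ((hm k).mul hh).aemeasurable, ← lintegral_indicator
    measurableSet_Ici, ← lintegral_const_mul _ (hh.indicator measurableSet_Ici)]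
  refine lintegral_congr fun v => ?_
  simp only [Pi.mul_apply]
  rw [ENNReal.tsum_mul_right]
  by_cases hv : 0 ≤ v
  · rw [Set.indicator_of_mem (Set.mem_Ici.2 hv), ← ENNReal.ofReal_tsum_of_nonneg
      (fun k => erlangPDFReal_nonneg hlam k v) (hasSum_erlangPDFReal lam hv).summable,
      (hasSum_erlangPDFReal lam hv).tsum_eq]
  · rw [Set.indicator_of_notMem (by simpa using hv)]
    simp [erlangPDFReal, hv]

/-- A crude bound on the density suffices: only the factorial decay in `k` matters, to beat
geometric factors later. -/
theorem measureReal_arrivalTime_le (hτ : ∀ k, Measurable (τ k))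
    (hlaw : ∀ k, P.map (τ k) = expMeasure lam) (hind : iIndepFun τ P) (hlam : 0 < lam)
    {t : ℝ} (ht : 0 ≤ t) (k : ℕ) :
    P.real {ω | arrivalTime τ k ω ≤ t} ≤ lam * t * ((lam * t) ^ k / k.factorial) := by
  have h1 : P {ω | arrivalTime τ k ω ≤ t} =
      ∫⁻ v in Set.Iic t, ENNReal.ofReal (erlangPDFReal lam k v) := by
    rw [← withDensity_apply _ measurableSet_Iic, ← map_arrivalTime hτ hlaw hind hlam,
      Measure.map_apply (measurable_arrivalTime hτ k) measurableSet_Iic]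
    rfl
  have h2 : ∫⁻ v in Set.Iic t, ENNReal.ofReal (erlangPDFReal lam k v) ≤
      ∫⁻ v in Set.Icc 0 t, ENNReal.ofReal (lam * ((lam * t) ^ k / k.factorial)) := by
    rw [← lintegral_indicator measurableSet_Iic, ← lintegral_indicator measurableSet_Icc]
    refine lintegral_mono fun v => ?_
    by_cases hv : v ∈ Set.Icc 0 t
    · rw [Set.indicator_of_mem hv, Set.indicator_of_mem (Set.mem_Iic.2 hv.2)]
      refine ENNReal.ofReal_le_ofReal ?_
      rw [erlangPDFReal, if_pos hv.1, mul_div_assoc]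
      have h0 := hv.1
      have h3 : Real.exp (-(lam * v)) ≤ 1 := Real.exp_le_one_iff.2 (by nlinarith)
      calc _ ≤ lam * ((lam * v) ^ k / k.factorial) * 1 := by gcongr
        _ ≤ _ := by rw [mul_one]; gcongr; exact hv.2
    · rw [Set.indicator_of_notMem hv]
      by_cases hvt : v ∈ Set.Iic t
      · rw [Set.indicator_of_mem hvt, erlangPDFReal, if_neg fun h => hv ⟨h, hvt⟩]
        simp
      · rw [Set.indicator_of_notMem hvt]
  rw [lintegral_const, Measure.restrict_apply_univ, Real.volume_Icc, sub_zero,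
    ← ENNReal.ofReal_mul (by positivity), ← h1] at h2
  refine (ENNReal.toReal_le_of_le_ofReal (by positivity) h2).trans_eq ?_
  ring

end Arrival

end JointRuin

end

/-! ### Pathwise reduction of joint ruin to the discounted claims. -/

noncomputable section

namespace JointRuin

variable {Ω : Type*}

/-- The aggregate claims up to time `t`, discounted to time `0`. -/
def discountedClaims (r : ℝ) (τ σ : ℕ → Ω → ℝ) (t : ℝ) (ω : Ω) : ℝ :=
  ∑ k ∈ Finset.range (claimCount τ t ω), Real.exp (-(r * arrivalTime τ k ω)) * σ k ω

/-- The discount integral `∫₀ᵗ e^{-rv} dv`. -/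
def annuity (r t : ℝ) : ℝ := ∫ v in (0 : ℝ)..t, Real.exp (-(r * v))

theorem annuity_nonneg (r : ℝ) {t : ℝ} (ht : 0 ≤ t) : 0 ≤ annuity r t :=
  intervalIntegral.integral_nonneg ht fun _ _ => (Real.exp_pos _).le

theorem annuity_le {r t : ℝ} (hr : 0 ≤ r) (ht : 0 ≤ t) : annuity r t ≤ t := by
  have h : annuity r t ≤ ∫ _ in (0 : ℝ)..t, (1 : ℝ) := by
    refine intervalIntegral.integral_mono_on ht (Continuous.intervalIntegrable (by fun_prop) _ _)
      (by simp) fun v hv => Real.exp_le_one_iff.2 ?_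
    have := mul_nonneg hr hv.1
    linarith
  simpa using h

theorem abs_mul_annuity_le {r t T : ℝ} (hr : 0 ≤ r) (ht : 0 ≤ t) (htT : t ≤ T) (p : ℝ) :
    |p * annuity r t| ≤ |p| * T := by
  rw [abs_mul, abs_of_nonneg (annuity_nonneg r ht)]
  exact mul_le_mul_of_nonneg_left ((annuity_le hr ht).trans htT) (abs_nonneg p)

theorem reserve_eq {r c δ : ℝ} (hδ : 0 < δ) (x : ℝ) (τ σ : ℕ → Ω → ℝ) (t : ℝ) (ω : Ω) :
    reserve r c δ (δ * x) τ σ t ω =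
      Real.exp (r * t) * δ * (x + c / δ * annuity r t - discountedClaims r τ σ t ω) := by
  have h1 : ∀ s, Real.exp (r * (t - s)) = Real.exp (r * t) * Real.exp (-(r * s)) := fun s => by
    rw [← Real.exp_add]; ring_nf
  simp only [reserve, discountedClaims, annuity, h1]
  rw [intervalIntegral.integral_const_mul]
  simp_rw [mul_assoc (Real.exp (r * t)) (Real.exp _)]
  rw [← Finset.mul_sum]
  field_simp

theorem reserve_neg_iff {r c δ : ℝ} (hδ : 0 < δ) (x : ℝ) (τ σ : ℕ → Ω → ℝ) (t : ℝ) (ω : Ω) :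
    reserve r c δ (δ * x) τ σ t ω < 0 ↔
      x + c / δ * annuity r t < discountedClaims r τ σ t ω := by
  rw [reserve_eq hδ, ← sub_neg (a := x + c / δ * annuity r t)]
  have : 0 < Real.exp (r * t) * δ := by positivity
  exact ⟨fun h => by nlinarith, fun h => by nlinarith⟩

theorem monotone_arrivalTime {τ : ℕ → Ω → ℝ} {ω : Ω} (hτ : ∀ k, 0 ≤ τ k ω) :
    Monotone fun k => arrivalTime τ k ω :=
  fun _ _ h => Finset.sum_le_sum_of_subset_of_nonneg (Finset.range_mono (by lia)) fun i _ _ => hτ i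

theorem arrivalTime_nonneg {τ : ℕ → Ω → ℝ} {ω : Ω} (hτ : ∀ k, 0 ≤ τ k ω) (k : ℕ) :
    0 ≤ arrivalTime τ k ω :=
  Finset.sum_nonneg fun i _ => hτ i

/-- Monotone arrival times make the set of arrived indices an initial segment. Finiteness is needed
because `ncard` is `0` on infinite sets. -/
theorem lt_claimCount_iff {τ : ℕ → Ω → ℝ} {ω : Ω} {t : ℝ} (hτ : ∀ k, 0 ≤ τ k ω)
    (hfin : {k | arrivalTime τ k ω ≤ t}.Finite) (k : ℕ) :
    k < claimCount τ t ω ↔ arrivalTime τ k ω ≤ t := by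
  classical
  have hex : ∃ n, ¬ arrivalTime τ n ω ≤ t := by
    by_contra! h
    exact Set.infinite_univ (hfin.subset fun n _ => h n)
  have hset : {k | arrivalTime τ k ω ≤ t} = Set.Iio (Nat.find hex) := by
    ext n
    refine ⟨fun h => ?_, fun h => not_not.1 (Nat.find_min hex h)⟩
    by_contra hn
    exact Nat.find_spec hex ((monotone_arrivalTime hτ (not_lt.1 hn)).trans h)
  have hcard : claimCount τ t ω = Nat.find hex := by
    rw [claimCount, hset, ← Finset.coe_Iio, Set.ncard_coe_finset, Nat.card_Iio]
  rw [hcard, ← Set.mem_Iio, ← hset, Set.mem_ofPred_eq]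

theorem minRuinTime_le_of_lt {r c₁ c₂ δ₁ δ₂ x₁ x₂ T : ℝ} (hr : 0 ≤ r) (hδ₁ : 0 < δ₁)
    (hT : 0 ≤ T) {τ σ : ℕ → Ω → ℝ} {ω : Ω}
    (h : x₁ + |c₁ / δ₁| * T < discountedClaims r τ σ T ω) :
    minRuinTime r c₁ c₂ δ₁ δ₂ (δ₁ * x₁) (δ₂ * x₂) τ σ ω ≤ (T : EReal) := by
  refine sInf_le ⟨T, ⟨hT, min_lt_of_left_lt ((reserve_neg_iff hδ₁ _ _ _ _ _).2 ?_)⟩, rfl⟩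
  have := (abs_le.1 (abs_mul_annuity_le hr hT le_rfl (c₁ / δ₁))).2
  linarith

theorem lt_of_minRuinTime_le {r c₁ c₂ δ₁ δ₂ x₁ x₂ T : ℝ} (hr : 0 ≤ r) (hδ₁ : 0 < δ₁)
    (hδ₂ : 0 < δ₂) (hx : x₁ ≤ x₂) {τ σ : ℕ → Ω → ℝ} {ω : Ω} (hτ : ∀ k, 0 ≤ τ k ω)
    (hσ : ∀ k, 0 ≤ σ k ω) (hfin : {k | arrivalTime τ k ω ≤ T + 1}.Finite)
    (h : minRuinTime r c₁ c₂ δ₁ δ₂ (δ₁ * x₁) (δ₂ * x₂) τ σ ω ≤ (T : EReal)) :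
    x₁ - (|c₁ / δ₁| + |c₂ / δ₂|) * (T + 1) < discountedClaims r τ σ T ω := by
  -- The infimum need not be attained, so the reserve may first be negative just after `T`. Finitely
  -- many arrivals up to `T + 1` leave room for some `s > T` with no arrival in `(T, s]`.
  have hev : ∀ᶠ s in 𝓝[>] T, ∀ k ∈ {k | arrivalTime τ k ω ≤ T + 1},
      T < arrivalTime τ k ω → s < arrivalTime τ k ω := by
    rw [eventually_all_finite hfin]
    intro k _
    by_cases hk : T < arrivalTime τ k ω
    · filter_upwards [Ioo_mem_nhdsGT hk] with s hs _ using hs.2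
    · exact Eventually.of_forall fun s h => absurd h hk
  obtain ⟨s, hs, hsT⟩ := (hev.and (Ioo_mem_nhdsGT (lt_add_one T))).exists
  have hlt := h.trans_lt (EReal.coe_lt_coe_iff.2 hsT.1)
  obtain ⟨_, ⟨t, ⟨ht0, hneg⟩, rfl⟩, hts⟩ := sInf_lt_iff.1 hlt
  have hts' : t < s := EReal.coe_lt_coe_iff.1 hts
  have htT : t ≤ T + 1 := (hts'.trans hsT.2).le
  have hle : discountedClaims r τ σ t ω ≤ discountedClaims r τ σ T ω := by
    refine Finset.sum_le_sum_of_subset_of_nonneg (fun k hk => ?_) fun k _ _ =>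
      mul_nonneg (Real.exp_pos _).le (hσ k)
    rw [Finset.mem_range, lt_claimCount_iff hτ (hfin.subset fun k hk => le_trans hk htT)] at hk
    rw [Finset.mem_range, lt_claimCount_iff hτ (hfin.subset fun k hk =>
      le_trans (b := T) hk (by linarith))]
    by_contra hkT
    have := hs k (hk.trans htT) (not_le.1 hkT)
    linarith
  have hT1 : 0 ≤ T + 1 := ht0.trans htT
  have h1 := (abs_le.1 (abs_mul_annuity_le hr ht0 htT (c₁ / δ₁))).1
  have h2 := (abs_le.1 (abs_mul_annuity_le hr ht0 htT (c₂ / δ₂))).1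
  have h3 := mul_nonneg (abs_nonneg (c₁ / δ₁)) hT1
  have h4 := mul_nonneg (abs_nonneg (c₂ / δ₂)) hT1
  rcases min_lt_iff.1 hneg with hn | hn
  · have := (reserve_neg_iff hδ₁ _ _ _ _ _).1 hn
    linarith
  · have := (reserve_neg_iff hδ₂ _ _ _ _ _).1 hn
    linarith

/-- If the sum of `n` terms exceeds `x`, then one term exceeds `(1 - η) x` or two terms exceed
`η x / n`. -/
theorem exists_large_of_lt_sum {n : ℕ} {a : ℕ → ℝ} {x η : ℝ} (hx : 0 < x) (hη : 0 < η)
    (hη1 : η < 1) (h : x < ∑ k ∈ Finset.range n, a k) :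
    (∃ k < n, (1 - η) * x < a k) ∨
      ∃ k < n, ∃ j < k, η * x / n < a j ∧ η * x / n < a k := by
  by_contra! hcon
  obtain ⟨h1, h2⟩ := hcon
  have hn : 0 < n := by
    rcases Nat.eq_zero_or_pos n with rfl | hn
    · simp at h; linarith
    · exact hn
  have hn' : (0 : ℝ) < n := Nat.cast_pos.2 hn
  have hy : 0 < η * x / n := by positivity
  have hny : n * (η * x / n) = η * x := by field_simp
  by_cases hex : ∃ k < n, η * x / n < a k
  · obtain ⟨k, hk, hak⟩ := hex
    -- With `a k` the only term above the threshold, the others total at most `η x`, while `a k ≤ (1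
    -- - η) x`.
    have hrest : ∑ j ∈ (Finset.range n).erase k, a j ≤
        ((Finset.range n).erase k).card • (η * x / n) := by
      refine Finset.sum_le_card_nsmul _ _ _ fun j hj => ?_
      rw [Finset.mem_erase, Finset.mem_range] at hj
      by_contra hja
      rcases lt_or_gt_of_ne hj.1 with hjk | hjk
      · exact absurd hak (not_lt.2 (h2 k hk j hjk (not_le.1 hja)))
      · exact hja (h2 j hj.2 k hjk hak)
    rw [← Finset.add_sum_erase _ _ (Finset.mem_range.2 hk)] at h
    have hcard : ((Finset.range n).erase k).card • (η * x / n) ≤ n * (η * x / n) := by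
      rw [nsmul_eq_mul]
      gcongr
      exact_mod_cast (Finset.card_le_card (Finset.erase_subset _ _)).trans_eq
        (Finset.card_range n)
    have := h1 k hk
    linarith
  · push Not at hex
    have hs : ∑ j ∈ Finset.range n, a j ≤ (Finset.range n).card • (η * x / n) :=
      Finset.sum_le_card_nsmul _ _ _ fun j hj => hex j (Finset.mem_range.1 hj)
    rw [Finset.card_range, nsmul_eq_mul, hny] at hs
    nlinarith

end JointRuin

end

/-! ### Regularly varying tails: domination, averaging, squeezing and shifts. -/

noncomputable section

namespace JointRuin

/-- `G` is regularly varying at infinity with index `-α`. -/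
def RegularlyVaryingTail (α : ℝ) (G : ℝ → ℝ) : Prop :=
  ∀ s : ℝ, 0 < s → Tendsto (fun x => G (s * x) / G x) atTop (𝓝 (s ^ (-α)))

theorem regularlyVaryingTail_of_slowlyVarying {L G : ℝ → ℝ} {α : ℝ} (hL : SlowlyVarying L)
    (hG : ∀ x, 0 < x → G x = L x / x ^ α) : RegularlyVaryingTail α G := by
  intro s hs
  have h := (hL.2 s hs).mul_const (s ^ (-α))
  rw [one_mul] at h
  refine h.congr' ?_
  filter_upwards [eventually_gt_atTop 0, hL.1] with x hx hLx
  rw [hG x hx, hG (s * x) (mul_pos hs hx), Real.mul_rpow hs.le hx.le, Real.rpow_neg hs.le]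
  have := Real.rpow_pos_of_pos hs α
  have := Real.rpow_pos_of_pos hx α
  field_simp

/-- Positivity holds far out, and monotonicity carries it back to every point. -/
theorem pos_of_slowlyVarying {L G : ℝ → ℝ} {α : ℝ} (hL : SlowlyVarying L)
    (hG : ∀ x, 0 < x → G x = L x / x ^ α) (hanti : Antitone G) (x : ℝ) : 0 < G x := by
  obtain ⟨y, ⟨hLy, hy⟩, hxy⟩ :=
    ((hL.1.and (eventually_gt_atTop 0)).and (eventually_ge_atTop x)).exists
  refine lt_of_lt_of_le ?_ (hanti hxy)
  rw [hG y hy]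
  exact div_pos hLy (Real.rpow_pos_of_pos hy α)

/-- A regularly varying tail has dominated variation, uniformly on `ℝ`. -/
theorem RegularlyVaryingTail.exists_div_two_pow_le {α : ℝ} {G : ℝ → ℝ}
    (h : RegularlyVaryingTail α G) (hpos : ∀ x, 0 < G x) (hanti : Antitone G)
    (hone : ∀ x, G x ≤ 1) :
    ∃ C : ℝ, 1 ≤ C ∧ ∀ (m : ℕ) (y : ℝ), G (y / 2 ^ m) ≤ C ^ m * G y := by
  obtain ⟨y₀, hy₀⟩ := eventually_atTop.1
    ((h (1 / 2) (by norm_num)).eventually_lt_const (lt_add_one _))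
  set B : ℝ := (1 / 2) ^ (-α) + 1
  -- `B` controls one halving beyond `y₀`; below `y₀`, `G ≤ 1` and `G y ≥ G y₀` make `(G y₀)⁻¹`
  -- enough.
  refine ⟨max 1 (max B (G y₀)⁻¹), le_max_left _ _, fun m => ?_⟩
  set C := max 1 (max B (G y₀)⁻¹)
  have hstep : ∀ y, G (y / 2) ≤ C * G y := by
    intro y
    rcases le_total y₀ y with hy | hy
    · have h1 := hy₀ y hy
      rw [div_lt_iff₀ (hpos y)] at h1
      rw [div_eq_inv_mul, ← one_div]
      refine h1.le.trans (mul_le_mul_of_nonneg_right ?_ (hpos y).le)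
      exact (le_max_left _ _).trans (le_max_right _ _)
    · have h1 : (G y₀)⁻¹ * G y₀ ≤ C * G y :=
        mul_le_mul ((le_max_right _ _).trans (le_max_right _ _)) (hanti hy) (hpos _).le
          (zero_le_one.trans (le_max_left _ _))
      rw [inv_mul_cancel₀ (hpos _).ne'] at h1
      exact (hone _).trans h1
  induction m with
  | zero => simp
  | succ m ih =>
    intro y
    rw [pow_succ', ← div_div]
    refine (ih (y / 2)).trans ?_
    rw [pow_succ, mul_assoc]
    exact mul_le_mul_of_nonneg_left (hstep y)
      (pow_nonneg (zero_le_one.trans (le_max_left _ _)) m)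

/-- The mean of a tail `G` over the discount factors `e^{-rv}`, `v ∈ (0, T]`. -/
def meanTail (r T : ℝ) (G : ℝ → ℝ) (x : ℝ) : ℝ :=
  T⁻¹ * ∫ v in (0 : ℝ)..T, G (x * Real.exp (r * v))

theorem intervalIntegrable_tail {r T x : ℝ} {G : ℝ → ℝ} (hr : 0 ≤ r) (hx : 0 ≤ x)
    (hanti : Antitone G) :
    IntervalIntegrable (fun v => G (x * Real.exp (r * v))) volume 0 T := by
  refine Antitone.intervalIntegrable fun v w hvw => hanti ?_
  gcongr

theorem le_meanTail {r T x : ℝ} {G : ℝ → ℝ} (hr : 0 ≤ r) (hT : 0 < T) (hx : 0 ≤ x)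
    (hanti : Antitone G) : G (x * Real.exp (r * T)) ≤ meanTail r T G x := by
  have h : ∫ _ in (0 : ℝ)..T, G (x * Real.exp (r * T)) ≤
      ∫ v in (0 : ℝ)..T, G (x * Real.exp (r * v)) := by
    refine intervalIntegral.integral_mono_on hT.le (by simp)
      (intervalIntegrable_tail hr hx hanti) fun v hv => hanti ?_
    have := hv.2
    gcongr
  rw [intervalIntegral.integral_const, sub_zero, smul_eq_mul] at h
  rwa [meanTail, le_inv_mul_iff₀ hT]

/-- Since `e^{rv} ≥ 1`, all arguments `x e^{rv}` lie beyond `x`, so one threshold for the ratio of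
`G` serves every `v`, and the estimate can be integrated. -/
theorem RegularlyVaryingTail.meanTail {α r T : ℝ} {G : ℝ → ℝ} (h : RegularlyVaryingTail α G)
    (hpos : ∀ x, 0 < G x) (hanti : Antitone G) (hr : 0 ≤ r) (hT : 0 < T) :
    RegularlyVaryingTail α (meanTail r T G) := by
  intro s hs
  rw [Metric.tendsto_atTop]
  intro ε hε
  obtain ⟨N, hN⟩ := Metric.tendsto_atTop.1 (h s hs) (ε / 2) (half_pos hε)
  refine ⟨max N 0, fun x hx => ?_⟩
  have hx0 : 0 ≤ x := (le_max_right _ _).trans hx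
  have hDpos : 0 < JointRuin.meanTail r T G x := (hpos _).trans_le (le_meanTail hr hT hx0 hanti)
  have hkey : ∀ v ∈ Set.Icc 0 T, |G (s * x * Real.exp (r * v)) -
      s ^ (-α) * G (x * Real.exp (r * v))| ≤ ε / 2 * G (x * Real.exp (r * v)) := by
    intro v hv
    have hge : N ≤ x * Real.exp (r * v) := by
      refine ((le_max_left _ _).trans hx).trans (le_mul_of_one_le_right hx0 ?_)
      exact Real.one_le_exp (mul_nonneg hr hv.1)
    have h1 := (hN _ hge).le
    rw [Real.dist_eq, ← mul_assoc, div_sub' (hpos _).ne', abs_div, abs_of_pos (hpos _),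
      div_le_iff₀ (hpos _), mul_comm (G _)] at h1
    exact h1
  have hi1 := intervalIntegrable_tail (T := T) hr (mul_nonneg hs.le hx0) hanti
  have hi2 := intervalIntegrable_tail (T := T) hr hx0 hanti
  have hint : |(∫ v in (0 : ℝ)..T, G (s * x * Real.exp (r * v))) -
      s ^ (-α) * ∫ v in (0 : ℝ)..T, G (x * Real.exp (r * v))| ≤
      ε / 2 * ∫ v in (0 : ℝ)..T, G (x * Real.exp (r * v)) := by
    rw [← intervalIntegral.integral_const_mul, ← intervalIntegral.integral_const_mul,
      ← intervalIntegral.integral_sub hi1 (hi2.const_mul _)]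
    refine (intervalIntegral.abs_integral_le_integral_abs hT.le).trans ?_
    exact intervalIntegral.integral_mono_on hT.le (hi1.sub (hi2.const_mul _)).abs
      (hi2.const_mul _) hkey
  rw [Real.dist_eq, div_sub' hDpos.ne', abs_div, abs_of_pos hDpos, div_lt_iff₀ hDpos]
  have hfin : |JointRuin.meanTail r T G (s * x) - JointRuin.meanTail r T G x * s ^ (-α)| ≤
      ε / 2 * JointRuin.meanTail r T G x := by
    have he : JointRuin.meanTail r T G (s * x) - JointRuin.meanTail r T G x * s ^ (-α) =
        T⁻¹ * ((∫ v in (0 : ℝ)..T, G (s * x * Real.exp (r * v))) -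
          s ^ (-α) * ∫ v in (0 : ℝ)..T, G (x * Real.exp (r * v))) := by
      simp only [JointRuin.meanTail]; ring
    rw [he, abs_mul, abs_of_pos (inv_pos.2 hT), JointRuin.meanTail]
    calc _ ≤ T⁻¹ * (ε / 2 * ∫ v in (0 : ℝ)..T, G (x * Real.exp (r * v))) := by gcongr
      _ = _ := by ring
  nlinarith

/-- The mean is at least `G (x e^{rT})`, which is comparable to `G x`; the remaining factor `G x`
tends to `0`. -/
theorem tendsto_sq_div_meanTail {α r T : ℝ} {G : ℝ → ℝ} (h : RegularlyVaryingTail α G)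
    (hpos : ∀ x, 0 < G x) (hanti : Antitone G) (hG0 : Tendsto G atTop (𝓝 0)) (hr : 0 ≤ r)
    (hT : 0 < T) : Tendsto (fun x => G x ^ 2 / meanTail r T G x) atTop (𝓝 0) := by
  have h1 := h (Real.exp (r * T)) (Real.exp_pos _)
  have hne : Real.exp (r * T) ^ (-α) ≠ 0 := (Real.rpow_pos_of_pos (Real.exp_pos _) _).ne'
  have h2 := hG0.mul (h1.inv₀ hne)
  rw [zero_mul] at h2
  refine squeeze_zero' ?_ ?_ h2
  · filter_upwards [eventually_ge_atTop 0] with x hx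
    exact div_nonneg (sq_nonneg _) ((hpos _).trans_le (le_meanTail hr hT hx hanti)).le
  · filter_upwards [eventually_ge_atTop 0] with x hx
    have h3 := le_meanTail hr hT hx hanti
    rw [inv_div, mul_comm (Real.exp _), ← mul_div_assoc, ← sq]
    exact div_le_div_of_nonneg_left (sq_nonneg _) (hpos _) h3

/-- A function `q` squeezed between `D(x)` and `D((1 - η) x)`, up to `o(D)`, is asymptotically
equivalent to the regularly varying tail `D`. -/
theorem tendsto_div_of_tail_bounds {α : ℝ} {D R q : ℝ → ℝ} (hD : RegularlyVaryingTail α D)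
    (hpos : ∀ x, 0 ≤ x → 0 < D x) (hR : Tendsto (fun x => R x / D x) atTop (𝓝 0))
    (hlow : ∃ K, ∀ x, 0 < x → D x - K * R x ≤ q x)
    (hup : ∀ η, 0 < η → η < 1 → ∃ K, ∀ x, 0 < x → q x ≤ D ((1 - η) * x) + K * R x) :
    Tendsto (fun x => q x / D x) atTop (𝓝 1) := by
  have hcont : Tendsto (fun η : ℝ => (1 - η) ^ (-α)) (𝓝[>] 0) (𝓝 1) := by
    have : ContinuousAt (fun η : ℝ => (1 - η) ^ (-α)) 0 :=
      ContinuousAt.rpow_const (by fun_prop) (Or.inl (by norm_num))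
    have h := this.tendsto.mono_left (nhdsWithin_le_nhds (s := Set.Ioi 0))
    simpa using h
  refine tendsto_order.2 ⟨fun a ha => ?_, fun a ha => ?_⟩
  · obtain ⟨K, hK⟩ := hlow
    have h1 := (hR.const_mul K).const_sub 1
    rw [mul_zero, sub_zero] at h1
    filter_upwards [h1.eventually_const_lt ha, eventually_gt_atTop 0] with x hx hx0
    refine hx.trans_le ?_
    have hDx := hpos x hx0.le
    rw [le_div_iff₀ hDx]
    refine le_trans (le_of_eq ?_) (hK x hx0)
    field_simp
  · obtain ⟨η, hη, hη0⟩ := ((hcont.eventually_lt_const ha).and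
      (Ioo_mem_nhdsGT (zero_lt_one' ℝ))).exists
    obtain ⟨K, hK⟩ := hup η hη0.1 hη0.2
    have h1 := (hD (1 - η) (by linarith [hη0.2])).add (hR.const_mul K)
    rw [mul_zero, add_zero] at h1
    filter_upwards [h1.eventually_lt_const hη, eventually_gt_atTop 0] with x hx hx0
    refine lt_of_le_of_lt ?_ hx
    have hDx := hpos x hx0.le
    rw [div_le_iff₀ hDx]
    refine (hK x hx0).trans (le_of_eq ?_)
    field_simp

/-- Bounded shifts do not change the asymptotics of a regularly varying tail. -/
theorem tendsto_shift_div {α : ℝ} {D q : ℝ → ℝ} (hD : RegularlyVaryingTail α D)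
    (hpos : ∀ x, 0 ≤ x → 0 < D x) (hq : Antitone q)
    (hqD : Tendsto (fun x => q x / D x) atTop (𝓝 1)) (a : ℝ) :
    Tendsto (fun x => q (x + a) / D x) atTop (𝓝 1) := by
  have hs : ∀ s : ℝ, 0 < s → Tendsto (fun x => q (s * x) / D x) atTop (𝓝 (s ^ (-α))) := by
    intro s hs
    have h := (hqD.comp (tendsto_id.const_mul_atTop hs)).mul (hD s hs)
    rw [one_mul] at h
    refine h.congr' ?_
    filter_upwards [eventually_gt_atTop 0] with x hx
    have := hpos (s * x) (mul_pos hs hx).le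
    have := hpos x hx.le
    simp only [Function.comp, id]
    field_simp
  have hcont : Tendsto (fun s : ℝ => s ^ (-α)) (𝓝 1) (𝓝 1) := by
    have : ContinuousAt (fun s : ℝ => s ^ (-α)) 1 :=
      ContinuousAt.rpow_const continuousAt_id (Or.inl one_ne_zero)
    simpa using this.tendsto
  -- For large `x` the shift is dominated by a dilation: `x + a ≤ s x` if `s > 1`, and `x + a ≥ s x`
  -- if `s < 1`. Then `s` is taken close to `1`.
  refine tendsto_order.2 ⟨fun b hb => ?_, fun b hb => ?_⟩
  · obtain ⟨s, hs1, hs2⟩ := (((hcont.mono_left nhdsWithin_le_nhds).eventually_const_lt hb).and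
      (Ioo_mem_nhdsGT one_lt_two)).exists
    have h0 : (0 : ℝ) < s - 1 := by linarith [hs2.1]
    filter_upwards [(hs s (by linarith)).eventually_const_lt hs1, eventually_ge_atTop 0,
      eventually_ge_atTop (a / (s - 1))] with x hx hx0 hxa
    refine hx.trans_le (div_le_div_of_nonneg_right (hq ?_) (hpos x hx0).le)
    rw [div_le_iff₀ h0] at hxa
    linarith
  · obtain ⟨s, hs1, hs2⟩ := (((hcont.mono_left nhdsWithin_le_nhds).eventually_lt_const hb).and
      (Ioo_mem_nhdsLT (zero_lt_one' ℝ))).exists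
    have h0 : (0 : ℝ) < 1 - s := by linarith [hs2.2]
    filter_upwards [(hs s hs2.1).eventually_lt_const hs1, eventually_ge_atTop 0,
      eventually_ge_atTop (-a / (1 - s))] with x hx hx0 hxa
    refine lt_of_le_of_lt (div_le_div_of_nonneg_right (hq ?_) (hpos x hx0).le) hx
    rw [div_le_iff₀ h0] at hxa
    linarith

end JointRuin

end

/-! ### Probabilities of one and of two large claims. -/

noncomputable section

namespace JointRuin

variable {Ω : Type*}

open scoped ENNReal

variable [MeasurableSpace Ω] {P : Measure Ω} {lam r T : ℝ}
  {τ σ : ℕ → Ω → ℝ}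

/-- The event that the claim with index `k` arrives up to time `T` and exceeds `x` after
discounting. -/
def largeClaim (r T : ℝ) (τ σ : ℕ → Ω → ℝ) (x : ℝ) (k : ℕ) : Set Ω :=
  {ω | arrivalTime τ k ω ≤ T ∧ x < Real.exp (-(r * arrivalTime τ k ω)) * σ k ω}

/-- The event that the claim with index `m` arrives up to time `T` and the claim sizes with indices
`j` and `k` exceed `y`. -/
def twoLargeClaims (T : ℝ) (τ σ : ℕ → Ω → ℝ) (y : ℝ) (m j k : ℕ) : Set Ω :=
  {ω | arrivalTime τ m ω ≤ T ∧ y < σ j ω ∧ y < σ k ω}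

/-- The tail of the claim size distribution. -/
def sizeTail (P : Measure Ω) (σ : ℕ → Ω → ℝ) (x : ℝ) : ℝ := P.real {ω | x < σ 0 ω}

theorem IsClaimModel.ae_wait_nonneg (h : IsClaimModel P lam τ σ) : ∀ᵐ ω ∂P, ∀ k, 0 ≤ τ k ω := by
  rw [ae_all_iff]
  intro k
  have h1 : ∀ᵐ v ∂(P.map (τ k)), 0 ≤ v := by
    rw [h.law_wait k, ae_iff]
    have : {v : ℝ | ¬ 0 ≤ v} = Set.Iio 0 := by ext; simp
    rw [this, expMeasure, gammaMeasure, withDensity_apply _ measurableSet_Iio]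
    exact lintegral_gammaPDF_of_nonpos le_rfl
  exact ae_of_ae_map (h.measurable_wait k).aemeasurable h1

theorem IsClaimModel.ae_size_nonneg (h : IsClaimModel P lam τ σ) : ∀ᵐ ω ∂P, ∀ k, 0 ≤ σ k ω :=
  ae_all_iff.2 h.nonneg_size

theorem sizeTail_nonneg (x : ℝ) : 0 ≤ sizeTail P σ x := measureReal_nonneg

variable [IsProbabilityMeasure P]

theorem sizeTail_antitone : Antitone (sizeTail P σ) := fun _ _ h =>
  measureReal_mono fun _ hω => lt_of_le_of_lt h hω

theorem sizeTail_le_one (x : ℝ) : sizeTail P σ x ≤ 1 := measureReal_le_one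

theorem tendsto_sizeTail (hσ : Measurable (σ 0)) : Tendsto (sizeTail P σ) atTop (𝓝 0) := by
  have h : Tendsto (fun x => P {ω | x < σ 0 ω}) atTop (𝓝 (P (⋂ x : ℝ, {ω | x < σ 0 ω}))) := by
    refine tendsto_measure_iInter_atTop (fun x => ?_) (fun x y h ω hω => lt_of_le_of_lt h hω)
      ⟨0, measure_ne_top _ _⟩
    exact (measurableSet_lt measurable_const hσ).nullMeasurableSet
  have he : (⋂ x : ℝ, {ω | x < σ 0 ω}) = ∅ := by
    ext ω
    simp only [Set.mem_iInter, Set.mem_ofPred_eq, Set.mem_empty_iff_false, iff_false, not_forall]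
    exact ⟨σ 0 ω, lt_irrefl _⟩
  rw [he, measure_empty] at h
  exact (ENNReal.tendsto_toReal ENNReal.zero_ne_top).comp h

theorem measurable_pi_arrivalTime (k : ℕ) :
    Measurable fun t : ℕ → ℝ => ∑ i ∈ Finset.range (k + 1), t i :=
  Finset.measurable_fun_sum _ fun i _ => measurable_pi_apply i

/-- The factor `(k + 1) ^ 2` bounds the number of pairs of claims, and `B ^ k` will hold the
dominated variation constant. -/
theorem IsClaimModel.summable_arrival (h : IsClaimModel P lam τ σ) (hlam : 0 < lam) {t : ℝ}
    (ht : 0 ≤ t) {B : ℝ} (hB : 0 ≤ B) :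
    Summable fun k : ℕ => P.real {ω | arrivalTime τ k ω ≤ t} * ((k + 1) ^ 2 * B ^ k) := by
  have hs := (Real.summable_pow_div_factorial (lam * t * (4 * B))).mul_left (lam * t)
  refine Summable.of_nonneg_of_le (fun k => by positivity) (fun k => ?_) hs
  have h1 := measureReal_arrivalTime_le h.measurable_wait h.law_wait h.indep_wait hlam ht k
  have h2 : ((k : ℝ) + 1) ^ 2 ≤ 4 ^ k := by
    have : (k : ℝ) + 1 ≤ 2 ^ k := by exact_mod_cast Nat.lt_two_pow_self (n := k)
    calc ((k : ℝ) + 1) ^ 2 ≤ (2 ^ k) ^ 2 := by gcongr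
      _ = 4 ^ k := by rw [← pow_mul, mul_comm, pow_mul]; norm_num
  calc _ ≤ lam * t * ((lam * t) ^ k / k.factorial) * (4 ^ k * B ^ k) := by gcongr
    _ = _ := by rw [mul_pow, mul_pow]; ring

/-- Borel–Cantelli, from the summable arrival probabilities. -/
theorem IsClaimModel.ae_finite_arrival (h : IsClaimModel P lam τ σ) (hlam : 0 < lam) {t : ℝ}
    (ht : 0 ≤ t) : ∀ᵐ ω ∂P, {k | arrivalTime τ k ω ≤ t}.Finite := by
  refine ae_finite_setOfPred_mem (s := fun k => {ω | arrivalTime τ k ω ≤ t}) ?_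
  have hs : Summable fun k : ℕ => P.real {ω | arrivalTime τ k ω ≤ t} := by
    refine Summable.of_nonneg_of_le (fun k => measureReal_nonneg) (fun k => ?_)
      (h.summable_arrival hlam ht zero_le_one)
    refine le_mul_of_one_le_right measureReal_nonneg ?_
    rw [one_pow, mul_one]
    exact one_le_pow₀ (by linarith [k.cast_nonneg (α := ℝ)])
  have he : ∀ k, P {ω | arrivalTime τ k ω ≤ t} =
      ENNReal.ofReal (P.real {ω | arrivalTime τ k ω ≤ t}) := fun k =>
    (ofReal_measureReal).symm
  simp_rw [he]
  rw [← ENNReal.ofReal_tsum_of_nonneg (fun k => measureReal_nonneg) hs]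
  exact ENNReal.ofReal_ne_top

theorem IsClaimModel.measure_largeClaim (h : IsClaimModel P lam τ σ) (x : ℝ) (k : ℕ) :
    P (largeClaim r T τ σ x k) = ∫⁻ v, (Set.Iic T).indicator
      (fun v => P.map (σ 0) {s | x < Real.exp (-(r * v)) * s}) v ∂(P.map (arrivalTime τ k)) := by
  have hm := measurable_arrivalTime h.measurable_wait k
  have hi : IndepFun (arrivalTime τ k) (σ k) P :=
    h.indep_wait_size.comp (measurable_pi_arrivalTime k) (measurable_pi_apply k)
  have hprod := (indepFun_iff_map_prod_eq_prod_map_map hm.aemeasurable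
    (h.measurable_size k).aemeasurable).1 hi
  have hset : MeasurableSet {p : ℝ × ℝ | p.1 ≤ T ∧ x < Real.exp (-(r * p.1)) * p.2} :=
    (measurableSet_le measurable_fst measurable_const).inter (measurableSet_lt measurable_const
      (by fun_prop : Measurable fun p : ℝ × ℝ => Real.exp (-(r * p.1)) * p.2))
  have h1 : P (largeClaim r T τ σ x k) = (P.map fun ω => (arrivalTime τ k ω, σ k ω))
      {p : ℝ × ℝ | p.1 ≤ T ∧ x < Real.exp (-(r * p.1)) * p.2} := by
    rw [Measure.map_apply (hm.prodMk (h.measurable_size k)) hset]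
    rfl
  have : IsProbabilityMeasure (P.map (σ 0)) :=
    Measure.isProbabilityMeasure_map (h.measurable_size 0).aemeasurable
  rw [h1, hprod, (h.identDistrib_size k).map_eq, Measure.prod_apply hset]
  refine lintegral_congr fun v => ?_
  by_cases hv : v ≤ T
  · rw [Set.indicator_of_mem (Set.mem_Iic.2 hv)]
    congr 1
    ext s
    simp [hv]
  · rw [Set.indicator_of_notMem (by simpa using hv)]
    convert measure_empty (μ := P.map (σ 0))
    ext s
    simp [hv]

theorem measurable_discounted_section (ν : Measure ℝ) [SFinite ν] (r x : ℝ) :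
    Measurable fun v : ℝ => ν {s | x < Real.exp (-(r * v)) * s} :=
  measurable_measure_prodMk_left (s := {p : ℝ × ℝ | x < Real.exp (-(r * p.1)) * p.2})
    (measurableSet_lt measurable_const (by fun_prop))

theorem discountedLaw_Ioi (ν : Measure ℝ) [SFinite ν] (r : ℝ) (T : ℝ) (x : ℝ) :
    discountedLaw r T ν (Set.Ioi x) =
      (ENNReal.ofReal T)⁻¹ * ∫⁻ v in Set.Ioc 0 T, ν {s | x < Real.exp (-(r * v)) * s} := by
  have hset : MeasurableSet {p : ℝ × ℝ | x < Real.exp (-(r * p.1)) * p.2} :=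
    measurableSet_lt measurable_const (by fun_prop)
  rw [discountedLaw, Measure.map_apply (by fun_prop) measurableSet_Ioi]
  have : (fun p : ℝ × ℝ => Real.exp (-(r * p.1)) * p.2) ⁻¹' Set.Ioi x =
    {p : ℝ × ℝ | x < Real.exp (-(r * p.1)) * p.2} := rfl
  rw [this, Measure.prod_apply hset, ProbabilityTheory.cond, lintegral_smul_measure, Real.volume_Ioc, sub_zero]
  rfl

/-- Summed over `k`, the arrival laws become `λ dv`; on `(0, T]` this is `λT` times the uniform law.
-/
theorem IsClaimModel.tsum_measure_largeClaim (h : IsClaimModel P lam τ σ) (hlam : 0 < lam)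
    (hT : 0 < T) (x : ℝ) :
    ∑' k, P (largeClaim r T τ σ x k) =
      ENNReal.ofReal lam * ENNReal.ofReal T * discountedLaw r T (P.map (σ 0)) (Set.Ioi x) := by
  have : IsProbabilityMeasure (P.map (σ 0)) :=
    Measure.isProbabilityMeasure_map (h.measurable_size 0).aemeasurable
  simp_rw [h.measure_largeClaim]
  rw [tsum_lintegral_map_arrivalTime h.measurable_wait h.law_wait h.indep_wait hlam
      ((measurable_discounted_section _ r x).indicator measurableSet_Iic),
    setLIntegral_indicator measurableSet_Iic, Set.inter_comm, Set.Ici_inter_Iic,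
    discountedLaw_Ioi, mul_assoc, ← mul_assoc (ENNReal.ofReal T),
    ENNReal.mul_inv_cancel (by simpa using hT) ENNReal.ofReal_ne_top, one_mul,
    setLIntegral_congr Ioc_ae_eq_Icc]

theorem discountedTail_eq_meanTail (hσ : Measurable (σ 0)) (hr : 0 ≤ r) (hT : 0 < T) {x : ℝ}
    (hx : 0 ≤ x) :
    discountedTail r T (P.map (σ 0)) x = meanTail r T (sizeTail P σ) x := by
  have : IsProbabilityMeasure (P.map (σ 0)) := Measure.isProbabilityMeasure_map hσ.aemeasurable
  rw [discountedTail, measureReal_def, discountedLaw_Ioi, meanTail, ENNReal.toReal_mul,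
    ENNReal.toReal_inv, ENNReal.toReal_ofReal hT.le, intervalIntegral.integral_of_le hT.le]
  congr 1
  have he : ∀ v, P.map (σ 0) {s | x < Real.exp (-(r * v)) * s} =
      ENNReal.ofReal (sizeTail P σ (x * Real.exp (r * v))) := by
    intro v
    have hset : {s | x < Real.exp (-(r * v)) * s} = Set.Ioi (x * Real.exp (r * v)) := by
      ext s
      rw [Set.mem_ofPred_eq, Set.mem_Ioi, Real.exp_neg, lt_inv_mul_iff₀ (Real.exp_pos _), mul_comm]
    rw [hset, Measure.map_apply hσ measurableSet_Ioi, sizeTail, ofReal_measureReal]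
    rfl
  simp_rw [he]
  rw [integral_eq_lintegral_of_nonneg_ae (ae_of_all _ fun v => sizeTail_nonneg _)]
  exact ((intervalIntegrable_iff_integrableOn_Ioc_of_le hT.le).1
    (intervalIntegrable_tail hr hx sizeTail_antitone)).aestronglyMeasurable

/-- The event involves undiscounted sizes, so it splits by independence even though both claims are
discounted along the same arrival process. -/
theorem IsClaimModel.measure_twoLargeClaims (h : IsClaimModel P lam τ σ) (y : ℝ) (m : ℕ)
    {j k : ℕ} (hjk : j ≠ k) :
    P (twoLargeClaims T τ σ y m j k) =
      ENNReal.ofReal (P.real {ω | arrivalTime τ m ω ≤ T} * sizeTail P σ y ^ 2) := by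
  have hlaw : ∀ i, P (σ i ⁻¹' Set.Ioi y) = ENNReal.ofReal (sizeTail P σ y) := by
    intro i
    rw [(h.identDistrib_size i).measure_mem_eq measurableSet_Ioi, sizeTail, ofReal_measureReal]
    rfl
  have hpair : MeasurableSet {s : ℕ → ℝ | y < s j ∧ y < s k} :=
    (measurableSet_lt measurable_const (measurable_pi_apply j)).inter
      (measurableSet_lt measurable_const (measurable_pi_apply k))
  have h1 := h.indep_wait_size.measure_inter_preimage_eq_mul
    {t : ℕ → ℝ | ∑ i ∈ Finset.range (m + 1), t i ≤ T} {s : ℕ → ℝ | y < s j ∧ y < s k}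
    (measurableSet_le (measurable_pi_arrivalTime m) measurable_const) hpair
  have h2 := (h.indep_size.indepFun hjk).measure_inter_preimage_eq_mul (Set.Ioi y) (Set.Ioi y)
    measurableSet_Ioi measurableSet_Ioi
  rw [hlaw, hlaw] at h2
  have h3 : P ((fun ω k => σ k ω) ⁻¹' {s : ℕ → ℝ | y < s j ∧ y < s k}) =
    ENNReal.ofReal (sizeTail P σ y) * ENNReal.ofReal (sizeTail P σ y) := h2
  rw [h3] at h1
  rw [ENNReal.ofReal_mul measureReal_nonneg, ofReal_measureReal, sq,
    ENNReal.ofReal_mul (sizeTail_nonneg y)]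
  exact h1

end JointRuin

end

/-! ### The single big jump: lower and upper bounds with quadratic error. -/

noncomputable section

namespace JointRuin

variable {Ω : Type*}

open scoped ENNReal

theorem size_gt_of_mem_largeClaim {r x : ℝ} {τ σ : ℕ → Ω → ℝ} {k : ℕ} {ω : Ω} (hr : 0 ≤ r)
    (hτ : ∀ k, 0 ≤ τ k ω) (hσ : ∀ k, 0 ≤ σ k ω)
    (h : x < Real.exp (-(r * arrivalTime τ k ω)) * σ k ω) : x < σ k ω := by
  refine h.trans_le (mul_le_of_le_one_left (hσ k) (Real.exp_le_one_iff.2 ?_))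
  have := mul_nonneg hr (arrivalTime_nonneg hτ k)
  linarith

variable [MeasurableSpace Ω] {P : Measure Ω} {lam r T : ℝ} {τ σ : ℕ → Ω → ℝ}

theorem IsClaimModel.measurableSet_largeClaim (h : IsClaimModel P lam τ σ) (x : ℝ) (k : ℕ) :
    MeasurableSet (largeClaim r T τ σ x k) := by
  have hm := measurable_arrivalTime h.measurable_wait k
  have hs := h.measurable_size k
  exact (measurableSet_le hm measurable_const).inter (measurableSet_lt measurable_const
    (by fun_prop : Measurable fun ω => Real.exp (-(r * arrivalTime τ k ω)) * σ k ω))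

/-- A Bonferroni inequality for countably many events. -/
theorem tsum_measure_le_measure_iUnion_add {E : ℕ → Set Ω} (hE : ∀ k, MeasurableSet (E k)) :
    ∑' k, P (E k) ≤ P (⋃ k, E k) + ∑' k, ∑ j ∈ Finset.range k, P (E j ∩ E k) := by
  rw [← iUnion_disjointed, measure_iUnion (disjoint_disjointed E) (MeasurableSet.disjointed hE),
    ← ENNReal.tsum_add]
  refine ENNReal.tsum_le_tsum fun k => ?_
  -- A point of `E k` either meets no earlier event or lies in an overlap with one.
  have hsub : E k ⊆ disjointed E k ∪ ⋃ j ∈ Finset.range k, E j ∩ E k := by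
    intro ω hω
    rw [disjointed_eq_inter_compl]
    by_cases hj : ∃ j < k, ω ∈ E j
    · obtain ⟨j, hjk, hj⟩ := hj
      exact Or.inr (Set.mem_biUnion (Finset.mem_range.2 hjk) ⟨hj, hω⟩)
    · push Not at hj
      exact Or.inl ⟨hω, Set.mem_iInter₂.2 hj⟩
  exact ((measure_mono hsub).trans (measure_union_le _ _)).trans
    (add_le_add_right (measure_biUnion_finset_le _ _) _)

theorem measure_pairs_le {A : ℕ → ℕ → Set Ω} {b : ℝ≥0∞} (hA : ∀ j k, j < k → P (A j k) ≤ b)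
    (n : ℕ) :
    P (⋃ k ∈ Finset.range n, ⋃ j ∈ Finset.range k, A j k) ≤ (n : ℝ≥0∞) ^ 2 * b := by
  refine (measure_biUnion_finset_le _ _).trans ?_
  have h1 : ∀ k ∈ Finset.range n, P (⋃ j ∈ Finset.range k, A j k) ≤ n * b := by
    intro k hk
    refine (measure_biUnion_finset_le _ _).trans ?_
    refine (Finset.sum_le_card_nsmul _ _ b fun j hj => hA j k (Finset.mem_range.1 hj)).trans ?_
    rw [Finset.card_range, nsmul_eq_mul]
    gcongr
    exact (Finset.mem_range.1 hk).le
  refine (Finset.sum_le_card_nsmul _ _ _ h1).trans_eq ?_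
  rw [Finset.card_range, nsmul_eq_mul, sq, mul_assoc]

variable [IsProbabilityMeasure P]

theorem IsClaimModel.tsum_largeClaim (h : IsClaimModel P lam τ σ) (hlam : 0 < lam) (hr : 0 ≤ r)
    (hT : 0 < T) {x : ℝ} (hx : 0 ≤ x) :
    ∑' k, P (largeClaim r T τ σ x k) =
      ENNReal.ofReal (lam * T * meanTail r T (sizeTail P σ) x) := by
  have hp : IsProbabilityMeasure (P.map (σ 0)) :=
    Measure.isProbabilityMeasure_map (h.measurable_size 0).aemeasurable
  have hfin : discountedLaw r T (P.map (σ 0)) (Set.Ioi x) ≠ ∞ := by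
    rw [discountedLaw_Ioi]
    refine ENNReal.mul_ne_top (by simpa using hT) (ne_top_of_le_ne_top ?_
      (lintegral_mono fun v => prob_le_one))
    simp
  rw [h.tsum_measure_largeClaim hlam hT,
    ← discountedTail_eq_meanTail (h.measurable_size 0) hr hT hx,
    ENNReal.ofReal_mul (by positivity), ENNReal.ofReal_mul hlam.le, discountedTail,
    ofReal_measureReal hfin]

/-- The probability that the discounted claims exceed `x` is at least the expected number of large
claims, up to a quadratic error. -/
theorem IsClaimModel.exists_le_discountedClaims (h : IsClaimModel P lam τ σ) (hlam : 0 < lam)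
    (hr : 0 ≤ r) (hT : 0 < T) :
    ∃ K, ∀ x, 0 < x → lam * T * meanTail r T (sizeTail P σ) x - K * sizeTail P σ x ^ 2 ≤
      P.real {ω | x < discountedClaims r τ σ T ω} := by
  set w : ℕ → ℝ := fun k => P.real {ω | arrivalTime τ k ω ≤ T} * ((k + 1) ^ 2 * 1 ^ k) with hw
  have hwnn : ∀ k, 0 ≤ w k := fun k => by positivity
  have hs : Summable w := h.summable_arrival hlam hT.le zero_le_one
  refine ⟨∑' k, w k, fun x hx => ?_⟩
  have hunion : P (⋃ k, largeClaim r T τ σ x k) ≤ P {ω | x < discountedClaims r τ σ T ω} := by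
    refine measure_mono_ae ?_
    filter_upwards [h.ae_wait_nonneg, h.ae_size_nonneg, h.ae_finite_arrival hlam hT.le]
      with ω hτ hσ hfin hω
    obtain ⟨k, hkT, hk⟩ := Set.mem_iUnion.1 hω
    refine lt_of_lt_of_le hk (Finset.single_le_sum (f := fun k =>
      Real.exp (-(r * arrivalTime τ k ω)) * σ k ω)
      (fun i _ => mul_nonneg (Real.exp_pos _).le (hσ i)) ?_)
    exact Finset.mem_range.2 ((lt_claimCount_iff hτ hfin k).2 hkT)
  have hpair : ∀ k, ∑ j ∈ Finset.range k, P (largeClaim r T τ σ x j ∩ largeClaim r T τ σ x k) ≤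
      ENNReal.ofReal (w k * sizeTail P σ x ^ 2) := by
    intro k
    have h1 : ∀ j ∈ Finset.range k, P (largeClaim r T τ σ x j ∩ largeClaim r T τ σ x k) ≤
        ENNReal.ofReal (P.real {ω | arrivalTime τ k ω ≤ T} * sizeTail P σ x ^ 2) := by
      intro j hj
      rw [← h.measure_twoLargeClaims x k (Finset.mem_range.1 hj).ne]
      refine measure_mono_ae ?_
      filter_upwards [h.ae_wait_nonneg, h.ae_size_nonneg] with ω hτ hσ hω
      exact ⟨hω.2.1, size_gt_of_mem_largeClaim hr hτ hσ hω.1.2,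
        size_gt_of_mem_largeClaim hr hτ hσ hω.2.2⟩
    refine (Finset.sum_le_card_nsmul _ _ _ h1).trans ?_
    rw [Finset.card_range, nsmul_eq_mul, ← ENNReal.ofReal_natCast,
      ← ENNReal.ofReal_mul (Nat.cast_nonneg k)]
    refine ENNReal.ofReal_le_ofReal ?_
    rw [← mul_assoc]
    refine mul_le_mul_of_nonneg_right ?_ (sq_nonneg _)
    simp only [hw, one_pow, mul_one]
    rw [mul_comm]
    refine mul_le_mul_of_nonneg_left ?_ measureReal_nonneg
    nlinarith [k.cast_nonneg (α := ℝ)]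
  have hmain := tsum_measure_le_measure_iUnion_add (P := P)
    (fun k => h.measurableSet_largeClaim (r := r) (T := T) x k)
  rw [h.tsum_largeClaim hlam hr hT hx.le] at hmain
  have h2 := hmain.trans (add_le_add hunion (ENNReal.tsum_le_tsum hpair))
  rw [← ENNReal.ofReal_tsum_of_nonneg (fun k => mul_nonneg (hwnn k) (sq_nonneg _))
    (hs.mul_right _), tsum_mul_right, ← ofReal_measureReal (μ := P),
    ← ENNReal.ofReal_add measureReal_nonneg (mul_nonneg (tsum_nonneg hwnn) (sq_nonneg _))] at h2
  have := (ENNReal.ofReal_le_ofReal_iff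
    (add_nonneg measureReal_nonneg (mul_nonneg (tsum_nonneg hwnn) (sq_nonneg _)))).1 h2
  linarith

/-- The probability that the discounted claims exceed `x` is at most the expected number of claims
exceeding `(1 - η) x`, up to a quadratic error. -/
theorem IsClaimModel.exists_discountedClaims_le (h : IsClaimModel P lam τ σ) (hlam : 0 < lam)
    (hr : 0 ≤ r) (hT : 0 < T) {C : ℝ} (hC : 1 ≤ C)
    (hdom : ∀ (m : ℕ) (y : ℝ), sizeTail P σ (y / 2 ^ m) ≤ C ^ m * sizeTail P σ y)
    {η : ℝ} (hη : 0 < η) (hη1 : η < 1) :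
    ∃ K, ∀ x, 0 < x → P.real {ω | x < discountedClaims r τ σ T ω} ≤
      lam * T * meanTail r T (sizeTail P σ) ((1 - η) * x) + K * sizeTail P σ x ^ 2 := by
  -- With `2⁻ⁱ < η` and `m + 1 ≤ 2 ^ m`, the threshold `η x / (m + 1)` is at least `x / 2 ^ (i +
  -- m)`. Squaring the tail bound there gives the weight `(C ^ 2) ^ m` and the constant `(C ^ i) ^
  -- 2`.
  obtain ⟨i, hi⟩ := exists_pow_lt_of_lt_one hη (by norm_num : (1 / 2 : ℝ) < 1)
  have hC0 : 0 ≤ C := zero_le_one.trans hC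
  set w : ℕ → ℝ := fun k =>
    P.real {ω | arrivalTime τ k ω ≤ T} * ((k + 1) ^ 2 * (C ^ 2) ^ k) with hw
  have hwnn : ∀ k, 0 ≤ w k := fun k => by positivity
  have hs : Summable w := h.summable_arrival hlam hT.le (by positivity)
  refine ⟨(∑' k, w k) * (C ^ i) ^ 2, fun x hx => ?_⟩
  have hη' : 0 < 1 - η := by linarith
  -- Here `m + 1` is the number of claims up to `T`; of this only the arrival of claim `m` by time
  -- `T` is retained.
  have hsub : P {ω | x < discountedClaims r τ σ T ω} ≤
      P ((⋃ k, largeClaim r T τ σ ((1 - η) * x) k) ∪ ⋃ m : ℕ, ⋃ k ∈ Finset.range (m + 1),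
        ⋃ j ∈ Finset.range k, twoLargeClaims T τ σ (η * x / (m + 1 : ℕ)) m j k) := by
    refine measure_mono_ae ?_
    filter_upwards [h.ae_wait_nonneg, h.ae_size_nonneg, h.ae_finite_arrival hlam hT.le]
      with ω hτ hσ hfin hω
    rcases exists_large_of_lt_sum hx hη hη1 hω with ⟨k, hk, hk'⟩ | ⟨k, hk, j, hj, hj', hk'⟩
    · exact Or.inl (Set.mem_iUnion.2 ⟨k, (lt_claimCount_iff hτ hfin k).1 hk, hk'⟩)
    · obtain ⟨m, hm⟩ := Nat.exists_eq_add_one_of_ne_zero (Nat.ne_zero_of_lt hk)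
      refine Or.inr (Set.mem_iUnion.2 ⟨m, Set.mem_biUnion (Finset.mem_range.2 (hm ▸ hk))
        (Set.mem_biUnion (Finset.mem_range.2 hj) ⟨?_, ?_, ?_⟩)⟩)
      · exact (lt_claimCount_iff hτ hfin m).1 (by lia)
      · exact size_gt_of_mem_largeClaim hr hτ hσ (hm ▸ hj')
      · exact size_gt_of_mem_largeClaim hr hτ hσ (hm ▸ hk')
  have hpair : ∀ m : ℕ, P (⋃ k ∈ Finset.range (m + 1),
      ⋃ j ∈ Finset.range k, twoLargeClaims T τ σ (η * x / (m + 1 : ℕ)) m j k) ≤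
      ENNReal.ofReal (w m * ((C ^ i) ^ 2 * sizeTail P σ x ^ 2)) := by
    intro m
    have hle : sizeTail P σ (η * x / (m + 1 : ℕ)) ≤ C ^ (i + m) * sizeTail P σ x := by
      refine le_trans (sizeTail_antitone ?_) (hdom (i + m) x)
      have h2m : ((m + 1 : ℕ) : ℝ) ≤ 2 ^ m := by exact_mod_cast Nat.lt_two_pow_self (n := m)
      rw [pow_add, ← div_div]
      refine div_le_div₀ (by positivity) ?_ (by positivity) h2m
      rw [one_div, inv_pow] at hi
      rw [div_eq_inv_mul]
      gcongr
    refine (measure_pairs_le (b := ENNReal.ofReal (P.real {ω | arrivalTime τ m ω ≤ T} *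
      sizeTail P σ (η * x / (m + 1 : ℕ)) ^ 2))
      (fun j k hjk => (h.measure_twoLargeClaims _ m hjk.ne).le) _).trans ?_
    rw [← ENNReal.ofReal_natCast, ← ENNReal.ofReal_pow (Nat.cast_nonneg _),
      ← ENNReal.ofReal_mul (by positivity)]
    refine ENNReal.ofReal_le_ofReal ?_
    have hsq : sizeTail P σ (η * x / (m + 1 : ℕ)) ^ 2 ≤ (C ^ (i + m) * sizeTail P σ x) ^ 2 :=
      pow_le_pow_left₀ (sizeTail_nonneg _) hle 2
    calc _ ≤ ((m + 1 : ℕ) : ℝ) ^ 2 * (P.real {ω | arrivalTime τ m ω ≤ T} *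
          (C ^ (i + m) * sizeTail P σ x) ^ 2) := by gcongr
      _ = _ := by rw [hw]; push_cast; ring
  have h2 := ((hsub.trans (measure_union_le _ _)).trans (add_le_add (measure_iUnion_le _)
    (measure_iUnion_le _))).trans (add_le_add_right (ENNReal.tsum_le_tsum hpair) _)
  have hnn : 0 ≤ (C ^ i) ^ 2 * sizeTail P σ x ^ 2 := by positivity
  have hD : 0 ≤ lam * T * meanTail r T (sizeTail P σ) ((1 - η) * x) :=
    mul_nonneg (by positivity)
      ((sizeTail_nonneg _).trans (le_meanTail hr hT (by positivity) sizeTail_antitone))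
  rw [h.tsum_largeClaim hlam hr hT (by positivity),
    ← ENNReal.ofReal_tsum_of_nonneg (fun k => mul_nonneg (hwnn k) hnn) (hs.mul_right _),
    tsum_mul_right, ← ofReal_measureReal (μ := P),
    ← ENNReal.ofReal_add hD (mul_nonneg (tsum_nonneg hwnn) hnn), ← mul_assoc] at h2
  exact (ENNReal.ofReal_le_ofReal_iff (add_nonneg hD (mul_nonneg (mul_nonneg (tsum_nonneg hwnn)
    (sq_nonneg _)) (sq_nonneg _)))).1 h2

end JointRuin

end

/-! ### The asymptotics of the joint ruin probability. -/

theorem theorem3p2 {Ω : Type*} [MeasurableSpace Ω] (P : Measure Ω) [IsProbabilityMeasure P]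
    (r lam c₁ c₂ δ₁ δ₂ : ℝ) (hr : 0 ≤ r) (hlam : 0 < lam)
    (hδ₁ : 0 < δ₁) (hδ₂ : 0 < δ₂) (hδ : δ₁ + δ₂ = 1) (hc : c₂ / δ₂ < c₁ / δ₁)
    (τ σ : ℕ → Ω → ℝ) (hmodel : JointRuin.IsClaimModel P lam τ σ)
    (L : ℝ → ℝ) (α : ℝ) (hα : 0 < α)
    (hLcont : ContinuousOn L (Set.Ioi 0)) (hLslow : JointRuin.SlowlyVarying L)
    (hLtop : Tendsto L atTop atTop)
    (htail : ∀ x : ℝ, 0 < x → P.real {ω | x < σ 0 ω} = L x / x ^ α)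
    (T : ℝ) (hT : 0 < T) :
    Tendsto
      (fun x : ℝ × ℝ =>
        JointRuin.minRuinProb P r c₁ c₂ δ₁ δ₂ τ σ x.1 x.2 T /
          (lam * T * JointRuin.discountedTail r T (P.map (σ 0)) x.1))
      JointRuin.orderedAtTop (𝓝 1) := by
  open JointRuin in
  have hanti : Antitone (sizeTail P σ) := sizeTail_antitone
  have hpos : ∀ x, 0 < sizeTail P σ x := pos_of_slowlyVarying hLslow htail hanti
  have hreg : RegularlyVaryingTail α (sizeTail P σ) :=
    regularlyVaryingTail_of_slowlyVarying hLslow htail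
  obtain ⟨C, hC, hdom⟩ := hreg.exists_div_two_pow_le hpos hanti sizeTail_le_one
  have hlT : 0 < lam * T := mul_pos hlam hT
  set D : ℝ → ℝ := fun x => lam * T * meanTail r T (sizeTail P σ) x with hDdef
  have hDreg : RegularlyVaryingTail α D := fun s hs => by
    simpa only [hDdef, mul_div_mul_left _ _ hlT.ne'] using hreg.meanTail hpos hanti hr hT s hs
  have hDpos : ∀ x, 0 ≤ x → 0 < D x := fun x hx =>
    mul_pos hlT ((hpos _).trans_le (le_meanTail hr hT hx hanti))
  have hR : Tendsto (fun x => sizeTail P σ x ^ 2 / D x) atTop (𝓝 0) := by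
    have h := (tendsto_sq_div_meanTail hreg hpos hanti (tendsto_sizeTail
      (hmodel.measurable_size 0)) hr hT).const_mul (lam * T)⁻¹
    rw [mul_zero] at h
    refine h.congr fun x => ?_
    rw [← div_eq_inv_mul, div_div, mul_comm (meanTail _ _ _ _)]
  have hq := tendsto_div_of_tail_bounds hDreg hDpos hR
    (hmodel.exists_le_discountedClaims hlam hr hT)
    (fun η hη hη1 => hmodel.exists_discountedClaims_le hlam hr hT hC hdom hη hη1)
  have hqanti : Antitone fun x => P.real {ω | x < discountedClaims r τ σ T ω} :=
    fun _ _ h => measureReal_mono fun _ hω => lt_of_le_of_lt h hω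
  have hfst : Tendsto (Prod.fst : ℝ × ℝ → ℝ) orderedAtTop atTop :=
    tendsto_comap.mono_left inf_le_left
  have hord : ∀ᶠ x : ℝ × ℝ in orderedAtTop, x.1 ≤ x.2 :=
    mem_inf_of_right (mem_principal_self _)
  -- Both squeezing bounds depend on `x₁` alone, which gives uniformity in `x₂ ≥ x₁`.
  have hlo := (tendsto_shift_div hDreg hDpos hqanti hq (|c₁ / δ₁| * T)).comp hfst
  have hhi := (tendsto_shift_div hDreg hDpos hqanti hq
    (-((|c₁ / δ₁| + |c₂ / δ₂|) * (T + 1)))).comp hfst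
  refine tendsto_of_tendsto_of_tendsto_of_le_of_le' hlo hhi ?_ ?_
  · filter_upwards [hfst.eventually_ge_atTop 0] with x hx
    rw [discountedTail_eq_meanTail (hmodel.measurable_size 0) hr hT hx]
    refine div_le_div_of_nonneg_right ?_ (hDpos _ hx).le
    exact measureReal_mono fun ω hω => minRuinTime_le_of_lt hr hδ₁ hT.le hω
  · filter_upwards [hfst.eventually_ge_atTop 0, hord] with x hx hx12
    rw [discountedTail_eq_meanTail (hmodel.measurable_size 0) hr hT hx]
    refine div_le_div_of_nonneg_right ?_ (hDpos _ hx).le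
    refine ENNReal.toReal_mono (measure_ne_top _ _) (measure_mono_ae ?_)
    filter_upwards [hmodel.ae_wait_nonneg, hmodel.ae_size_nonneg,
      hmodel.ae_finite_arrival hlam (by linarith : 0 ≤ T + 1)] with ω hτ hσ hfin hω
    rw [← sub_eq_add_neg]
    exact lt_of_minRuinTime_le hr hδ₁ hδ₂ hx12 hτ hσ hfin hω
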